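/- **Theorem (Wiener's lemma for Følner sequences).** Let $G$ be a locally compact abelian (Hausdorff) group with dual group $\widehat G$ (the continuous characters $\gamma : G\to\{z\in\mathbb C : |z|=1\}$), and let $m_{\widehat G}$ be a (regular) Haar measure on $\widehat G$, with any normalization. Let $\mu$ be a complex regular Borel measure on $G$, that is, a countably additive set function from the Borel sets of $G$ to $\mathbb C$ whose total variation $|\mu|$ is a regular measure, and put $$\widehat\mu(\gamma)=\int_G\overline{\gamma(y)}\,\mathrm d\mu(y),\qquad \gamma\in\widehat G .$$ Let $(F_n)$ be a Følner sequence in $\widehat G$: a sequence of subsets of $\widehat G$ such that, for all sufficiently large $n$, $F_n$ is Borel measurable with $0<m_{\widehat G}(F_n)<\infty$, and such that for every $\gamma\in\widehat G$ $$\lim_{n\to\infty}\frac{m_{\widehat G}\bigl((\gamma F_n)\,\Delta\, F_n\bigr)}{m_{\widehat G}(F_n)}=0 .$$ Then, for every $x\in G$, $$\mu(\{x\})=\lim_{n\to\infty}\frac1{m_{\widehat G}(F_n)}\int_{F_n}\gamma(x)\,\widehat\mu(\gamma)\,\mathrm dm_{\widehat G}(\gamma).$$ -/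

import Mathlib

namespace WienerFolner

/-- The Fourier transform (Fourier-Stieltjes transform) of a complex Borel measure `μ` on `G`,
`μ̂(γ) = ∫_G conj (γ x) dμ(x)`, as a function of the character `γ : G → Circle`. The integral is
the integral of a complex function against the complex measure `μ`, paired through the
multiplication of `ℂ`. -/
noncomputable def fourierTransform {G : Type*} [CommGroup G] [TopologicalSpace G]
    [MeasurableSpace G] (μ : MeasureTheory.ComplexMeasure G) (γ : PontryaginDual G) : ℂ :=
  μ.integral (fun x : G => (starRingEnd ℂ) ((γ x : Circle) : ℂ)) (ContinuousLinearMap.mul ℝ ℂ)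

end WienerFolner

open MeasureTheory Filter Topology
open scoped Pointwise symmDiff

/-! Write `μ` as `h` times its variation, with `‖h‖ = 1` almost everywhere. Fubini
(`integral_character_mul_fourierTransform`) turns the `n`-th average into the integral of `a n (x *
y⁻¹) * h y`, where `a n` averages the characters over `F n`. Since `a n` is bounded by `1` and tends
pointwise to the indicator of `{1}` (`tendsto_average_apply`), dominated convergence gives `μ {x}`.

For `y ≠ 1`, translating `F n` by a character `γ₀` with `γ₀ y ≠ 1` multiplies `a n y` by `γ₀ y` but
changes it by at most the Følner ratio, so `a n y → 0`. Such a `γ₀` comes from the regular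
representation on `L²`: a Gelfand character of the commutative C⋆-algebra it generates as a double
commutant restricts to a character of the group. -/

namespace WienerFolner

/-! ### Gelfand theory on double commutants -/

/-- A nonzero element of a commutative C⋆-algebra is detected by a character. -/
theorem exists_character_apply_ne_zero {A : Type*} [CommCStarAlgebra A] {a : A} (ha : a ≠ 0) :
    ∃ φ : WeakDual.characterSpace ℂ A, φ a ≠ 0 := by
  by_contra! h
  refine ha ((gelfandTransform_isometry A).injective ?_)
  ext φ
  simpa using h φ

/-- The commutant of a star-closed set is star-closed, so requiring commutation with adjoints as
well adds nothing. -/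
theorem coe_starSubalgebra_centralizer_centralizer {A : Type*} [CStarAlgebra A] {s : Set A}
    (hstar : star s = s) :
    ((StarSubalgebra.centralizer ℂ s.centralizer : StarSubalgebra ℂ A) : Set A)
      = s.centralizer.centralizer := by
  have h : star s.centralizer = s.centralizer := by
    have h := StarMemClass.star_coe_eq (StarSubalgebra.centralizer ℂ s)
    rwa [StarSubalgebra.coe_centralizer, hstar, Set.union_self] at h
  rw [StarSubalgebra.coe_centralizer, h, Set.union_self]

/-- If a star-closed set of operators is commutative, each nonzero element `a` of its double
centralizer is detected by a character of the double centralizer. -/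
theorem exists_character_centralizer_centralizer {A : Type*} [CStarAlgebra A] {s : Set A}
    (hs : ∀ x ∈ s, ∀ y ∈ s, x * y = y * x) (hstar : star s = s)
    {a : StarSubalgebra.centralizer ℂ s.centralizer} (ha : a ≠ 0) :
    ∃ φ : StarSubalgebra.centralizer ℂ s.centralizer →⋆ₐ[ℂ] ℂ,
      (∀ x, ‖φ x‖ ≤ ‖x‖) ∧ φ a ≠ 0 := by
  have hcoe := coe_starSubalgebra_centralizer_centralizer hstar
  have : IsClosed ((StarSubalgebra.centralizer ℂ s.centralizer : StarSubalgebra ℂ A) : Set A) := by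
    rw [hcoe]; exact Set.isClosed_centralizer _
  let _ : CommCStarAlgebra (StarSubalgebra.centralizer ℂ s.centralizer : StarSubalgebra ℂ A) :=
    { StarSubalgebra.cstarAlgebra (StarSubalgebra.centralizer ℂ s.centralizer) with
      mul_comm := fun x y ↦ Subtype.ext <|
        Set.centralizer_centralizer_comm_of_comm hs _ (hcoe ▸ x.2) _ (hcoe ▸ y.2) }
  obtain ⟨φ, hφ⟩ := exists_character_apply_ne_zero ha
  have : Nontrivial (StarSubalgebra.centralizer ℂ s.centralizer : StarSubalgebra ℂ A) :=
    ⟨a, 0, ha⟩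
  exact ⟨⟨WeakDual.CharacterSpace.toAlgHom φ, fun x ↦ map_star φ x⟩,
    fun x ↦ AlgHom.norm_apply_le_self (WeakDual.CharacterSpace.toAlgHom φ) x, hφ⟩

/-! ### Integrated operators of unitary representations -/

section UnitaryRepresentation

variable {G H : Type*} [Group G] [TopologicalSpace G]
  [MeasurableSpace G] [BorelSpace G]
  [NormedAddCommGroup H] [InnerProductSpace ℂ H] [CompleteSpace H]

theorem norm_unitary_apply (u : unitary (H →L[ℂ] H)) (x : H) : ‖(u : H →L[ℂ] H) x‖ = ‖x‖ :=
  (Unitary.linearIsometryEquiv u).norm_map x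

variable (μ : Measure G) [IsFiniteMeasureOnCompacts μ] (U : G →* unitary (H →L[ℂ] H))

theorem integrable_smul_unitary (hU : ∀ v, Continuous fun g ↦ (U g : H →L[ℂ] H) v)
    {f : G → ℝ} (hf : Continuous f) (hfc : HasCompactSupport f) (v : H) :
    Integrable (fun g ↦ f g • (U g : H →L[ℂ] H) v) μ :=
  (hf.smul (hU v)).integrable_of_hasCompactSupport hfc.smul_right

/-- The operator `∫ f(g) U(g) dμ(g)`. -/
noncomputable def integratedOperator (hU : ∀ v, Continuous fun g ↦ (U g : H →L[ℂ] H) v)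
    (f : G → ℝ) (hf : Continuous f) (hfc : HasCompactSupport f) : H →L[ℂ] H :=
  LinearMap.mkContinuous
    { toFun := fun v ↦ ∫ g, f g • (U g : H →L[ℂ] H) v ∂μ
      map_add' := fun v w ↦ by
        simp only [map_add, smul_add]
        exact integral_add (integrable_smul_unitary μ U hU hf hfc v)
          (integrable_smul_unitary μ U hU hf hfc w)
      map_smul' := fun c v ↦ by
        simp only [map_smul, RingHom.id_apply]
        rw [← integral_smul]
        simp only [smul_comm c] }
    (∫ g, ‖f g‖ ∂μ) fun v ↦ by
      refine (norm_integral_le_integral_norm _).trans (le_of_eq ?_)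
      simp only [norm_smul, norm_unitary_apply]
      rw [integral_mul_const]

variable {μ U}
variable {hU : ∀ v, Continuous fun g ↦ (U g : H →L[ℂ] H) v} {f : G → ℝ} {hf : Continuous f}
  {hfc : HasCompactSupport f}

theorem integratedOperator_apply (v : H) :
    integratedOperator μ U hU f hf hfc v = ∫ g, f g • (U g : H →L[ℂ] H) v ∂μ := rfl

/-- An operator commuting with every `U g` passes under the integral. Gelfand characters of the
double commutant can therefore be evaluated at the integrated operator. -/
theorem integratedOperator_mem_centralizer_centralizer :
    integratedOperator μ U hU f hf hfc ∈
      (Set.range fun g ↦ (U g : H →L[ℂ] H)).centralizer.centralizer := by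
  intro S hS
  ext v
  simp only [mul_apply_eq_comp, integratedOperator_apply]
  rw [← ContinuousLinearMap.integral_comp_comm S (integrable_smul_unitary μ U hU hf hfc v)]
  congr 1 with g
  rw [ContinuousLinearMap.map_smul_of_tower]
  exact congrArg (f g • ·) (DFunLike.congr_fun (hS _ ⟨g, rfl⟩) v).symm

/-- By invariance, `U k` acts on the integrated operator by translating `f`. This gives norm control
where `U` itself is only strongly continuous. -/
theorem norm_unitary_mul_integratedOperator_sub_le [IsTopologicalGroup G]
    [μ.IsMulLeftInvariant] (k : G) :
    ‖(U k : H →L[ℂ] H) * integratedOperator μ U hU f hf hfc - integratedOperator μ U hU f hf hfc‖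
      ≤ ∫ g, ‖f (k⁻¹ * g) - f g‖ ∂μ := by
  refine ContinuousLinearMap.opNorm_le_bound _ (by positivity) fun v ↦ ?_
  have h1 : (U k : H →L[ℂ] H) (integratedOperator μ U hU f hf hfc v)
      = ∫ g, f (k⁻¹ * g) • (U g : H →L[ℂ] H) v ∂μ := by
    rw [integratedOperator_apply,
      ← ContinuousLinearMap.integral_comp_comm _ (integrable_smul_unitary μ U hU hf hfc v),
      ← integral_mul_left_eq_self (fun g ↦ f (k⁻¹ * g) • (U g : H →L[ℂ] H) v) k]
    congr 1 with g
    rw [ContinuousLinearMap.map_smul_of_tower]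
    simp
  have hf' : Continuous fun g ↦ f (k⁻¹ * g) := hf.comp (continuous_const_mul _)
  have hfc' : HasCompactSupport fun g ↦ f (k⁻¹ * g) :=
    hfc.comp_homeomorph (Homeomorph.mulLeft k⁻¹)
  rw [sub_apply, mul_apply_eq_comp, h1, integratedOperator_apply,
    ← integral_sub (integrable_smul_unitary μ U hU hf' hfc' v)
      (integrable_smul_unitary μ U hU hf hfc v)]
  refine (norm_integral_le_integral_norm _).trans (le_of_eq ?_)
  simp only [← sub_smul, norm_smul, norm_unitary_apply]
  rw [integral_mul_const]

end UnitaryRepresentation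

/-! ### Continuous characters separate points -/

/-- Translation is continuous in `L¹` on compactly supported continuous functions. -/
theorem tendsto_integral_norm_translate_sub {G : Type*} [Group G] [TopologicalSpace G]
    [IsTopologicalGroup G] [MeasurableSpace G] [BorelSpace G] [LocallyCompactSpace G]
    {μ : Measure G} [μ.IsHaarMeasure] [μ.Regular] {f : G → ℝ} (hf : Continuous f)
    (hfc : HasCompactSupport f) :
    Tendsto (fun k : G ↦ ∫ g, ‖f (k⁻¹ * g) - f g‖ ∂μ) (𝓝 1) (𝓝 0) := by
  have : Fact ((1 : ENNReal) ≠ ⊤) := ⟨ENNReal.one_ne_top⟩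
  have hL : MemLp f 1 μ := memLp_one_iff_integrable.2 (hf.integrable_of_hasCompactSupport hfc)
  have hc : Continuous fun k : G ↦ ‖DomMulAct.mk k⁻¹ • hL.toLp f - hL.toLp f‖ := by
    have : Continuous fun k : G ↦ DomMulAct.mk k⁻¹ := by fun_prop
    fun_prop
  have h := hc.tendsto 1
  have he : ∀ k : G, ‖DomMulAct.mk k⁻¹ • hL.toLp f - hL.toLp f‖
      = ∫ g, ‖f (k⁻¹ * g) - f g‖ ∂μ := fun k ↦ by
    rw [DomMulAct.mk_smul_toLp, ← MemLp.toLp_sub, L1.norm_eq_integral_norm]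
    refine integral_congr_ae ?_
    filter_upwards [MemLp.coeFn_toLp ((hL.comp_measurePreserving <|
      measurePreserving_smul k⁻¹ μ).sub hL)] with g hg
    exact congrArg norm hg
  simp only [he] at h
  simpa using h

theorem exists_bump {G : Type*} [Group G] [TopologicalSpace G] [IsTopologicalGroup G]
    [MeasurableSpace G] [BorelSpace G] [LocallyCompactSpace G] (μ : Measure G) [μ.IsHaarMeasure]
    {V : Set G} (hV : V ∈ 𝓝 1) :
    ∃ f : G → ℝ, Continuous f ∧ HasCompactSupport f ∧ (∀ g, 0 ≤ f g) ∧ (∀ g ∉ V, f g = 0) ∧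
      0 < ∫ g, f g ∂μ := by
  obtain ⟨f, hf1, hfc, hfV, hf01⟩ := exists_continuousMap_one_of_isCompact_subset_isOpen
    (isCompact_singleton (x := (1 : G))) isOpen_interior
    (Set.singleton_subset_iff.2 (mem_interior_iff_mem_nhds.2 hV))
  refine ⟨f, f.continuous, hfc, fun g ↦ (hf01 g).1, fun g hg ↦ ?_, ?_⟩
  · by_contra h
    exact hg (interior_subset (hfV (subset_tsupport _ h)))
  · refine f.continuous.integral_pos_of_hasCompactSupport_nonneg_nonzero hfc
      (fun g ↦ (hf01 g).1) (x := 1) ?_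
    have := hf1 (Set.mem_singleton 1)
    simp_all

/-- If a strongly continuous unitary representation moves a vector under `g₀`, then some
continuous character is nontrivial at `g₀`. -/
theorem exists_pontryaginDual_apply_ne_one_of_unitary {G H : Type*} [CommGroup G]
    [TopologicalSpace G] [IsTopologicalGroup G] [MeasurableSpace G] [BorelSpace G]
    [LocallyCompactSpace G] [NormedAddCommGroup H] [InnerProductSpace ℂ H] [CompleteSpace H]
    (U : G →* unitary (H →L[ℂ] H)) (hU : ∀ v, Continuous fun g ↦ (U g : H →L[ℂ] H) v)
    {g₀ : G} {v : H} (hv : (U g₀ : H →L[ℂ] H) v ≠ v) : ∃ γ : PontryaginDual G, γ g₀ ≠ 1 := by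
  set μ : Measure G := Measure.haar
  have hpos : 0 < ‖(U g₀ : H →L[ℂ] H) v - v‖ := norm_pos_iff.2 (sub_ne_zero.2 hv)
  set ε := ‖(U g₀ : H →L[ℂ] H) v - v‖ / 3 with hε
  have hV : {g | ‖(U g : H →L[ℂ] H) v - v‖ < ε} ∈ 𝓝 (1 : G) := by
    have hc : Continuous fun g ↦ ‖(U g : H →L[ℂ] H) v - v‖ := ((hU v).sub continuous_const).norm
    refine (isOpen_lt hc continuous_const).mem_nhds ?_
    simp only [Set.mem_ofPred_eq, map_one, OneMemClass.coe_one, one_apply_eq_self, sub_self,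
      norm_zero]
    positivity
  obtain ⟨f, hf, hfc, hf0, hfV, hfpos⟩ := exists_bump μ hV
  set T := integratedOperator μ U hU f hf hfc with hT
  have hTv : ‖T v - (∫ g, f g ∂μ) • v‖ ≤ ε * ∫ g, f g ∂μ := by
    have hfi : Integrable f μ := hf.integrable_of_hasCompactSupport hfc
    rw [hT, integratedOperator_apply, ← integral_smul_const,
      ← integral_sub (integrable_smul_unitary μ U hU hf hfc v) (hfi.smul_const v),
      ← integral_const_mul]
    refine norm_integral_le_of_norm_le (hfi.const_mul ε) (ae_of_all _ fun g ↦ ?_)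
    rw [← smul_sub, norm_smul, Real.norm_of_nonneg (hf0 g), mul_comm ε]
    by_cases hg : ‖(U g : H →L[ℂ] H) v - v‖ < ε
    · exact mul_le_mul_of_nonneg_left hg.le (hf0 g)
    · simp [hfV g hg]
  -- If `U g₀ * T = T`, then, as `T v` is within `ε * c` of `c • v` and `U g₀` is isometric, `c • v`
  -- moves by at most `2 * ε * c`; by the choice of `ε` it moves by `3 * ε * c`.
  have hne : (U g₀ : H →L[ℂ] H) * T - T ≠ 0 := by
    intro h
    have h0 : (U g₀ : H →L[ℂ] H) (T v) = T v := by
      have := DFunLike.congr_fun h v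
      simpa [sub_eq_zero] using this
    set c := ∫ g, f g ∂μ
    have h1 : c • ((U g₀ : H →L[ℂ] H) v - v)
        = (T v - c • v) - (U g₀ : H →L[ℂ] H) (T v - c • v) := by
      rw [map_sub, h0, ContinuousLinearMap.map_smul_of_tower, smul_sub]
      abel
    have h2 : c * (3 * ε) ≤ 2 * (ε * c) := by
      calc c * (3 * ε) = ‖c • ((U g₀ : H →L[ℂ] H) v - v)‖ := by
            rw [norm_smul, Real.norm_of_nonneg hfpos.le, hε]; ring
        _ ≤ ‖T v - c • v‖ + ‖(U g₀ : H →L[ℂ] H) (T v - c • v)‖ := by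
            rw [h1]; exact norm_sub_le _ _
        _ ≤ 2 * (ε * c) := by rw [norm_unitary_apply]; linarith
    have hεpos : 0 < ε := by positivity
    nlinarith [mul_pos hεpos hfpos]
  set s : Set (H →L[ℂ] H) := Set.range fun g ↦ (U g : H →L[ℂ] H) with hs
  have hcomm : ∀ x ∈ s, ∀ y ∈ s, x * y = y * x := by
    rintro _ ⟨g, rfl⟩ _ ⟨k, rfl⟩
    simp only [← Submonoid.coe_mul, ← map_mul, mul_comm]
  have hstar : star s = s := by
    have h : ∀ g, star (U g : H →L[ℂ] H) = U g⁻¹ := fun g ↦ by rw [map_inv]; rfl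
    ext x
    constructor
    · rintro ⟨g, hg⟩
      refine ⟨g⁻¹, ?_⟩
      simp only at hg ⊢
      rw [← h, hg, star_star]
    · rintro ⟨g, rfl⟩
      exact ⟨g⁻¹, by simp only [h]⟩
  have hcoe := coe_starSubalgebra_centralizer_centralizer hstar
  have hUs : ∀ g, (U g : H →L[ℂ] H) ∈ StarSubalgebra.centralizer ℂ s.centralizer := fun g ↦ by
    rw [← SetLike.mem_coe, hcoe]; exact Set.subset_centralizer_centralizer ⟨g, rfl⟩
  have hTs : T ∈ StarSubalgebra.centralizer ℂ s.centralizer := by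
    rw [← SetLike.mem_coe, hcoe]; exact integratedOperator_mem_centralizer_centralizer
  let u : G → StarSubalgebra.centralizer ℂ s.centralizer := fun g ↦ ⟨U g, hUs g⟩
  let t : StarSubalgebra.centralizer ℂ s.centralizer := ⟨T, hTs⟩
  have hut : u g₀ * t - t ≠ 0 := fun h ↦ hne (congrArg Subtype.val h)
  -- Since `φ (u g * t - t) = (φ (u g) - 1) * φ t`, nonvanishing at `g₀` yields both nontriviality
  -- there and `φ t ≠ 0`; the latter allows the division that proves continuity.
  obtain ⟨φ, hφle, hφ⟩ := exists_character_centralizer_centralizer hcomm hstar hut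
  have hφsub : ∀ g, φ (u g * t - t) = (φ (u g) - 1) * φ t := fun g ↦ by
    rw [map_sub, map_mul, sub_mul, one_mul]
  have hu1 : u 1 = 1 := Subtype.ext (by simp [u])
  have humul : ∀ g k, u (g * k) = u g * u k := fun g k ↦ Subtype.ext (by simp [u])
  have hunorm : ∀ g, φ (u g) ∈ Submonoid.unitSphere ℂ := fun g ↦ by
    have h1 : star (u g) * u g = 1 := Subtype.ext (Unitary.coe_star_mul_self (U g))
    have h2 : star (φ (u g)) * φ (u g) = 1 := by rw [← map_star, ← map_mul, h1, map_one]
    have h3 : ‖φ (u g)‖ * ‖φ (u g)‖ = 1 := by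
      rw [← CStarRing.norm_star_mul_self, h2, norm_one]
    rw [← sq, pow_eq_one_iff_of_nonneg (norm_nonneg _) two_ne_zero] at h3
    exact mem_sphere_zero_iff_norm.2 h3
  rw [hφsub] at hφ
  let χ : G →* Circle :=
    { toFun := fun g ↦ ⟨φ (u g), hunorm g⟩
      map_one' := Subtype.ext (by simp [hu1])
      map_mul' := fun g k ↦ Subtype.ext <| by
        change φ (u (g * k)) = φ (u g) * φ (u k)
        rw [humul, map_mul] }
  have hχ : Continuous χ := by
    refine continuous_of_continuousAt_one χ ?_
    rw [ContinuousAt, map_one, tendsto_iff_dist_tendsto_zero]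
    have hlim : Tendsto (fun k : G ↦ (∫ g, ‖f (k⁻¹ * g) - f g‖ ∂μ) / ‖φ t‖) (𝓝 1) (𝓝 0) := by
      simpa using (tendsto_integral_norm_translate_sub (μ := μ) hf hfc).div_const ‖φ t‖
    refine squeeze_zero (fun _ ↦ dist_nonneg) (fun k ↦ ?_) hlim
    rw [le_div_iff₀ (norm_pos_iff.2 (right_ne_zero_of_mul hφ))]
    calc dist (χ k) 1 * ‖φ t‖ = ‖φ (u k * t - t)‖ := by
          rw [hφsub, norm_mul, ← dist_eq_norm]; rfl
      _ ≤ ‖u k * t - t‖ := hφle _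
      _ ≤ _ := norm_unitary_mul_integratedOperator_sub_le (hU := hU) (hf := hf) (hfc := hfc) k
  refine ⟨⟨χ, hχ⟩, fun h ↦ left_ne_zero_of_mul hφ ?_⟩
  rw [sub_eq_zero]
  exact congrArg Subtype.val h

/-- The translation representation of a commutative group on `L²` of an invariant measure. -/
noncomputable def translationRep {G : Type*} [CommGroup G] [TopologicalSpace G]
    [IsTopologicalGroup G] [MeasurableSpace G] [BorelSpace G] (μ : Measure G)
    [μ.IsMulLeftInvariant] : G →* (Lp ℂ 2 μ ≃ₗᵢ[ℂ] Lp ℂ 2 μ) where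
  toFun g :=
    { toFun := fun v ↦ DomMulAct.mk g • v
      invFun := fun v ↦ DomMulAct.mk g⁻¹ • v
      left_inv := fun v ↦ by simp
      right_inv := fun v ↦ by simp
      map_add' := fun v w ↦ smul_add _ v w
      map_smul' := fun c v ↦ smul_comm _ c v
      norm_map' := fun v ↦ DomMulAct.norm_smul_Lp _ v }
  map_one' := by
    ext1 v
    exact one_smul (DomMulAct G) v
  map_mul' g k := by
    ext1 v
    change DomMulAct.mk (g * k) • v = DomMulAct.mk g • DomMulAct.mk k • v
    rw [smul_smul, mul_comm g k, DomMulAct.mk_mul]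

/-- The continuous characters of a locally compact abelian Hausdorff group separate points. -/
theorem exists_pontryaginDual_apply_ne_one {G : Type*} [CommGroup G] [TopologicalSpace G]
    [IsTopologicalGroup G] [T2Space G] [LocallyCompactSpace G] {g₀ : G} (hg₀ : g₀ ≠ 1) :
    ∃ γ : PontryaginDual G, γ g₀ ≠ 1 := by
  borelize G
  set μ : Measure G := Measure.haar
  have : Fact ((2 : ENNReal) ≠ ⊤) := ⟨ENNReal.ofNat_ne_top⟩
  obtain ⟨A, B, hA, hB, hA1, hB1, hAB⟩ := t2_separation hg₀.symm
  obtain ⟨O, hO1, hO, hOμ⟩ := μ.exists_isOpen_measure_lt_top 1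
  -- `W` is a neighbourhood of `1` of finite measure with `g₀ • W ⊆ B` disjoint from `W ⊆ A`, so
  -- translation by `g₀` moves its indicator in `L²`.
  set W := A ∩ (fun x ↦ g₀ • x) ⁻¹' B ∩ O with hW
  have hWo : IsOpen W := (hA.inter (hB.preimage (continuous_const_smul g₀))).inter hO
  have hW1 : (1 : G) ∈ W := ⟨⟨hA1, by simpa using hB1⟩, hO1⟩
  have hWμ : μ W ≠ ⊤ := ((measure_mono Set.inter_subset_right).trans_lt hOμ).ne
  set U : G →* unitary (Lp ℂ 2 μ →L[ℂ] Lp ℂ 2 μ) :=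
    (Unitary.linearIsometryEquiv.symm.toMonoidHom).comp (translationRep μ)
  have hUapply : ∀ g v, (U g : Lp ℂ 2 μ →L[ℂ] Lp ℂ 2 μ) v = DomMulAct.mk g • v := fun g v ↦ rfl
  refine exists_pontryaginDual_apply_ne_one_of_unitary U (fun v ↦ ?_)
    (v := indicatorConstLp 2 hWo.measurableSet hWμ (1 : ℂ)) fun h ↦ ?_
  · simp only [hUapply]
    have : Continuous fun k : G ↦ DomMulAct.mk k := by fun_prop
    fun_prop
  · rw [hUapply, DomMulAct.mk_smul_indicatorConstLp] at h
    have h' := (indicatorConstLp_inj _ _ _ _ one_ne_zero).1 h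
    have hsub : W ⊆ W \ ((g₀ • ·) ⁻¹' W) := fun x hx ↦
      ⟨hx, fun hx' ↦ Set.disjoint_left.1 hAB hx'.1.1 hx.1.2⟩
    exact (hWo.measure_pos μ ⟨1, hW1⟩).ne' (measure_mono_null hsub (ae_eq_set.1 h').2)

/-! ### Averages of characters along a Følner sequence -/

theorem continuous_pontryaginDual_eval {G : Type*} [CommGroup G] [TopologicalSpace G]
    [LocallyCompactSpace G] :
    Continuous fun p : PontryaginDual G × G ↦ ((p.1 p.2 : Circle) : ℂ) := by
  have : ContinuousEval (PontryaginDual G) G Circle :=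
    inferInstanceAs (ContinuousEval (G →ₜ* Circle) G Circle)
  exact continuous_induced_dom.comp continuous_eval

/-- The integrals over `A ∩ B` cancel. -/
theorem norm_setIntegral_sub_setIntegral_le {X : Type*} [MeasurableSpace X] {m : Measure X}
    {E : Type*} [NormedAddCommGroup E] [NormedSpace ℝ E] {f : X → E} {A B : Set X}
    (hA : MeasurableSet A) (hB : MeasurableSet B) (hmA : m A ≠ ⊤) (hmB : m B ≠ ⊤)
    (hf : AEStronglyMeasurable f m) (hf1 : ∀ x, ‖f x‖ ≤ 1) :
    ‖∫ x in A, f x ∂m - ∫ x in B, f x ∂m‖ ≤ m.real (A ∆ B) := by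
  have hint : ∀ {C}, m C ≠ ⊤ → IntegrableOn f C m := fun hC ↦
    Measure.integrableOn_of_bounded hC hf (M := 1) (ae_of_all _ hf1)
  rw [← integral_inter_add_sdiff hB (hint hmA), ← integral_inter_add_sdiff hA (hint hmB),
    Set.inter_comm B A, add_sub_add_left_eq_sub]
  have hAB : m (A \ B) < ⊤ := (measure_mono Set.sdiff_subset).trans_lt hmA.lt_top
  have hBA : m (B \ A) < ⊤ := (measure_mono Set.sdiff_subset).trans_lt hmB.lt_top
  calc _ ≤ ‖∫ x in A \ B, f x ∂m‖ + ‖∫ x in B \ A, f x ∂m‖ := norm_sub_le _ _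
    _ ≤ 1 * m.real (A \ B) + 1 * m.real (B \ A) :=
      add_le_add (norm_setIntegral_le_of_norm_le_const hAB fun x _ ↦ hf1 x)
        (norm_setIntegral_le_of_norm_le_const hBA fun x _ ↦ hf1 x)
    _ = m.real (A ∆ B) := by
      rw [one_mul, one_mul, measureReal_symmDiff_eq hA hB]

section Average

variable {G : Type*} [CommGroup G] [TopologicalSpace G]

theorem continuous_pontryaginDual_apply [LocallyCompactSpace G] (y : G) :
    Continuous fun γ : PontryaginDual G ↦ ((γ y : Circle) : ℂ) :=
  continuous_pontryaginDual_eval.comp (by fun_prop : Continuous fun γ : PontryaginDual G ↦ (γ, y))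

theorem setIntegral_smul_pontryaginDual [MeasurableSpace (PontryaginDual G)]
    [BorelSpace (PontryaginDual G)] (m : Measure (PontryaginDual G)) [m.IsMulLeftInvariant]
    (γ₀ : PontryaginDual G) (A : Set (PontryaginDual G)) (y : G) :
    ∫ γ in γ₀ • A, ((γ y : Circle) : ℂ) ∂m
      = ((γ₀ y : Circle) : ℂ) * ∫ γ in A, ((γ y : Circle) : ℂ) ∂m := by
  have h := (measurePreserving_smul γ₀ m).setIntegral_image_emb
    (measurableEmbedding_const_smul γ₀) (fun γ ↦ ((γ y : Circle) : ℂ)) A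
  rw [← integral_const_mul]
  exact h

/-- The averages of the characters along a Følner sequence converge to the indicator function of
the identity. -/
theorem tendsto_average_apply [IsTopologicalGroup G] [T2Space G] [LocallyCompactSpace G]
    [MeasurableSpace (PontryaginDual G)] [BorelSpace (PontryaginDual G)]
    {m : Measure (PontryaginDual G)} [m.IsMulLeftInvariant]
    {F : ℕ → Set (PontryaginDual G)} (hF : IsFoelner (PontryaginDual G) m atTop F) (y : G) :
    Tendsto (fun n ↦ ((m.real (F n) : ℝ) : ℂ)⁻¹ * ∫ γ in F n, ((γ y : Circle) : ℂ) ∂m) atTop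
      (𝓝 (Set.indicator {1} 1 y)) := by
  by_cases hy : y = 1
  · subst hy
    refine tendsto_const_nhds.congr' ?_
    filter_upwards [hF.eventually_meas_ne_zero, hF.eventually_meas_ne_top] with n h0 ht
    have : m.real (F n) ≠ 0 := (ENNReal.toReal_pos h0 ht).ne'
    simp [this]
  obtain ⟨γ₀, hγ₀⟩ := exists_pontryaginDual_apply_ne_one hy
  have hne : ((γ₀ y : Circle) : ℂ) - 1 ≠ 0 := by
    rw [sub_ne_zero]
    exact fun h ↦ hγ₀ (Circle.ext h)
  rw [Set.indicator_of_notMem (by simpa using hy)]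
  have hlim : Tendsto
      (fun n ↦ (m ((γ₀ • F n) ∆ F n) / m (F n)).toReal / ‖((γ₀ y : Circle) : ℂ) - 1‖)
      atTop (𝓝 0) := by
    simpa using ((ENNReal.tendsto_toReal ENNReal.zero_ne_top).comp
      (hF.tendsto_meas_smul_symmDiff γ₀)).div_const ‖((γ₀ y : Circle) : ℂ) - 1‖
  refine squeeze_zero_norm' ?_ hlim
  filter_upwards [hF.eventually_meas_ne_zero, hF.eventually_meas_ne_top,
    hF.eventually_measurableSet] with n h0 ht hm
  -- `γ₀ y - 1` times the integral over `F n` is the difference of the integrals over `γ₀ • F n` and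
  -- `F n`.
  rw [le_div_iff₀ (norm_pos_iff.2 hne), ENNReal.toReal_div, norm_mul, norm_inv, mul_assoc,
    ← norm_mul, mul_comm (∫ γ in F n, _ ∂m), sub_mul, one_mul, ← setIntegral_smul_pontryaginDual,
    Complex.norm_real,
    Real.norm_of_nonneg measureReal_nonneg, div_eq_inv_mul]
  refine mul_le_mul_of_nonneg_left ?_ (by positivity)
  exact norm_setIntegral_sub_setIntegral_le (hm.const_smul γ₀) hm (by rwa [measure_smul]) ht
    (continuous_pontryaginDual_apply y).aestronglyMeasurable (fun γ ↦ (Circle.norm_coe _).le)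

end Average

/-! ### Polar decomposition of complex measures -/

section ComplexMeasure

variable {X : Type*} [MeasurableSpace X] (μ : ComplexMeasure X)

instance isFiniteMeasure_variation : IsFiniteMeasure μ.variation := by
  refine isFiniteMeasure_of_le
    ((ComplexMeasure.re μ).totalVariation + (ComplexMeasure.im μ).totalVariation)
    (VectorMeasure.variation_le_of_forall_enorm_le fun s _ ↦ ?_)
  calc ‖μ s‖ₑ = ‖((μ s).re : ℂ) + (μ s).im * Complex.I‖ₑ := by rw [Complex.re_add_im]
    _ ≤ ‖((μ s).re : ℂ)‖ₑ + ‖((μ s).im : ℂ) * Complex.I‖ₑ := enorm_add_le _ _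
    _ = ‖(μ s).re‖ₑ + ‖(μ s).im‖ₑ := by simp [← ofReal_norm]
    _ ≤ _ := add_le_add (SignedMeasure.enorm_le_totalVariation (ComplexMeasure.re μ) s)
        (SignedMeasure.enorm_le_totalVariation (ComplexMeasure.im μ) s)

/-- Polar decomposition of a complex measure. -/
theorem exists_density_variation :
    ∃ h : X → ℂ, Integrable h μ.variation ∧ (∀ᵐ x ∂μ.variation, ‖h x‖ = 1) ∧
      ∀ s, MeasurableSet s → μ s = ∫ x in s, h x ∂μ.variation := by
  set ν := μ.variation with hν
  have hac : ∀ s, MeasurableSet s → ν.toENNRealVectorMeasure s = 0 → μ s = 0 := fun s hs h ↦ by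
    rw [Measure.toENNRealVectorMeasure_apply_measurable hs] at h
    have := VectorMeasure.enorm_measure_le_variation μ s
    rw [← hν, h] at this
    simpa using this
  have hre : ν.withDensityᵥ ((ComplexMeasure.re μ).rnDeriv ν) = ComplexMeasure.re μ :=
    SignedMeasure.withDensityᵥ_rnDeriv_eq _ _ 
      (.mk fun s hs h ↦ congrArg Complex.re (hac s hs h))
  have him : ν.withDensityᵥ ((ComplexMeasure.im μ).rnDeriv ν) = ComplexMeasure.im μ :=
    SignedMeasure.withDensityᵥ_rnDeriv_eq _ _ 
      (.mk fun s hs h ↦ congrArg Complex.im (hac s hs h))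
  set a := (ComplexMeasure.re μ).rnDeriv ν
  set b := (ComplexMeasure.im μ).rnDeriv ν
  have ha : Integrable a ν := SignedMeasure.integrable_rnDeriv _ _
  have hb : Integrable b ν := SignedMeasure.integrable_rnDeriv _ _
  have hint : Integrable (fun x ↦ (a x : ℂ) + b x * Complex.I) ν :=
    ha.ofReal.add (hb.ofReal.mul_const _)
  have happly : ∀ s, MeasurableSet s → μ s = ∫ x in s, ((a x : ℂ) + b x * Complex.I) ∂ν := by
    intro s hs
    rw [integral_add ha.ofReal.restrict (hb.ofReal.mul_const _).restrict,
      integral_mul_const, integral_complex_ofReal, integral_complex_ofReal, ← withDensityᵥ_apply ha hs,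
      ← withDensityᵥ_apply hb hs, hre, him]
    exact (Complex.re_add_im _).symm
  refine ⟨_, hint, ?_, happly⟩
  have hμ : ν.withDensityᵥ (fun x ↦ (a x : ℂ) + b x * Complex.I) = μ := by
    ext s hs
    rw [withDensityᵥ_apply hint hs, happly s hs]
  -- The variation of a measure with density has the norm of that density as its density; here that
  -- variation is `ν` itself, which forces norm `1`.
  have hv := Measure.variation_withDensityᵥ hint
  rw [hμ, ← hν] at hv
  have h1 : ν.withDensity 1 = ν.withDensity fun x ↦ ‖(a x : ℂ) + b x * Complex.I‖ₑ := by
    rw [withDensity_one]; exact hv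
  have h2 := (withDensity_eq_iff measurable_one.aemeasurable hint.aestronglyMeasurable.enorm
    (by simp)).1 h1
  filter_upwards [h2] with x hx
  rw [← toReal_enorm, ← hx, Pi.one_apply, ENNReal.toReal_one]

variable {μ}

/-- Both sides agree on indicators, are additive, and are continuous in `L¹`, the right one because
`‖h‖ = 1`. -/
theorem integral_mul_eq_of_density {h : X → ℂ} (hint : Integrable h μ.variation)
    (hh1 : ∀ᵐ x ∂μ.variation, ‖h x‖ = 1)
    (hh : ∀ s, MeasurableSet s → μ s = ∫ x in s, h x ∂μ.variation)
    {f : X → ℂ} (hf : Integrable f μ.variation) :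
    μ.integral f (ContinuousLinearMap.mul ℝ ℂ) = ∫ x, f x * h x ∂μ.variation := by
  have hmul : ∀ {g : X → ℂ}, Integrable g μ.variation →
      Integrable (fun x ↦ g x * h x) μ.variation := fun hg ↦
    hg.mul_bdd hint.aestronglyMeasurable (hh1.mono fun x hx ↦ hx.le)
  apply hf.induction (P := fun f ↦ μ.integral f (ContinuousLinearMap.mul ℝ ℂ)
    = ∫ x, f x * h x ∂μ.variation)
  · intro c s hs _
    rw [VectorMeasure.integral_indicator_const _ hs]
    simp_rw [← Set.indicator_mul_left]
    rw [integral_indicator hs, integral_const_mul, ← hh s hs]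
    rfl
  · intro f g _ hf hg hPf hPg
    rw [VectorMeasure.integral_add hf hg, hPf, hPg, ← integral_add (hmul hf) (hmul hg)]
    simp [add_mul]
  · refine isClosed_eq VectorMeasure.continuous_integral ?_
    refine LipschitzWith.continuous (K := 1) (LipschitzWith.of_dist_le_mul fun f g ↦ ?_)
    rw [NNReal.coe_one, one_mul, dist_eq_norm, dist_eq_norm,
      ← integral_sub (hmul (L1.integrable_coeFn f)) (hmul (L1.integrable_coeFn g)),
      L1.norm_eq_integral_norm]
    refine norm_integral_le_of_norm_le (L1.integrable_coeFn (f - g)).norm ?_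
    filter_upwards [hh1, Lp.coeFn_sub f g] with x hx hfg
    rw [← sub_mul, norm_mul, hx, mul_one, hfg, Pi.sub_apply]
  · intro f g hfg _ hPf
    rw [← VectorMeasure.integral_congr_ae hfg, hPf]
    exact integral_congr_ae (hfg.mono fun x hx ↦ by simp only [hx])

end ComplexMeasure

/-! ### Joint measurability without second countability -/

section Product

theorem exists_seq_isCompact_measure_compl_iUnion {X : Type*} [TopologicalSpace X] [T2Space X]
    [MeasurableSpace X] [BorelSpace X] (m : Measure X) [IsFiniteMeasure m]
    [m.InnerRegularCompactLTTop] :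
    ∃ K : ℕ → Set X, (∀ n, IsCompact (K n)) ∧ ∀ᵐ x ∂m, x ∈ ⋃ n, K n := by
  have h : ∀ n : ℕ, ∃ K : Set X, IsCompact K ∧ m Kᶜ < ((n : ENNReal) + 1)⁻¹ := fun n ↦ by
    obtain ⟨K, -, hK, hmK⟩ := MeasurableSet.univ.exists_isCompact_sdiff_lt (measure_ne_top m _)
      (ε := ((n : ENNReal) + 1)⁻¹) (by simp)
    exact ⟨K, hK, by rwa [Set.compl_eq_univ_sdiff]⟩
  choose K hK hmK using h
  refine ⟨K, hK, ?_⟩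
  rw [ae_iff]
  refine le_antisymm (ENNReal.le_of_forall_pos_le_add fun ε hε _ ↦ ?_) zero_le
  obtain ⟨n, hn⟩ := ENNReal.exists_inv_nat_lt (a := (ε : ENNReal)) (by simpa using hε.ne')
  rw [zero_add]
  calc m {x | ¬ x ∈ ⋃ n, K n} ≤ m (K n)ᶜ :=
        measure_mono fun x hx hxn ↦ hx (Set.mem_iUnion.2 ⟨n, hxn⟩)
    _ ≤ ((n : ENNReal) + 1)⁻¹ := (hmK n).le
    _ ≤ (n : ENNReal)⁻¹ := ENNReal.inv_le_inv.2 le_self_add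
    _ ≤ ε := hn.le

/-- A continuous function on a product of locally compact spaces is almost everywhere strongly
measurable for the product of finite inner regular Borel measures. -/
theorem aestronglyMeasurable_prod_of_continuous {X Y : Type*} [TopologicalSpace X] [T2Space X]
    [LocallyCompactSpace X] [MeasurableSpace X] [BorelSpace X] [TopologicalSpace Y] [T2Space Y]
    [LocallyCompactSpace Y] [MeasurableSpace Y] [BorelSpace Y] (m : Measure X) [IsFiniteMeasure m]
    [m.InnerRegularCompactLTTop] (ν : Measure Y) [IsFiniteMeasure ν] [ν.InnerRegularCompactLTTop]
    {k : X × Y → ℂ} (hk : Continuous k) : AEStronglyMeasurable k (m.prod ν) := by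
  obtain ⟨K, hK, hmK⟩ := exists_seq_isCompact_measure_compl_iUnion m
  obtain ⟨L, hL, hνL⟩ := exists_seq_isCompact_measure_compl_iUnion ν
  have hmem : ∀ᵐ p ∂m.prod ν, p ∈ ⋃ i : ℕ × ℕ, K i.1 ×ˢ L i.2 := by
    filter_upwards [Measure.quasiMeasurePreserving_fst.ae hmK,
      Measure.quasiMeasurePreserving_snd.ae hνL] with p hp hq
    obtain ⟨i, hi⟩ := Set.mem_iUnion.1 hp
    obtain ⟨j, hj⟩ := Set.mem_iUnion.1 hq
    exact Set.mem_iUnion.2 ⟨(i, j), hi, hj⟩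
  rw [← Measure.restrict_eq_self_of_ae_mem hmem, aestronglyMeasurable_iUnion_iff]
  rintro ⟨i, j⟩
  -- The product σ-algebra may miss Borel sets of the product, so `k` is cut off by `u p.1 * v p.2`:
  -- compact support restores strong measurability, and nothing changes on `K i ×ˢ L j`.
  obtain ⟨u, hu1, huc, -⟩ :=
    exists_continuousMap_one_of_isCompact_subset_isOpen (hK i) isOpen_univ (Set.subset_univ _)
  obtain ⟨v, hv1, hvc, -⟩ :=
    exists_continuousMap_one_of_isCompact_subset_isOpen (hL j) isOpen_univ (Set.subset_univ _)
  have hc : Continuous fun p : X × Y ↦ ((u p.1 * v p.2 : ℝ) : ℂ) * k p := by fun_prop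
  have hs : HasCompactSupport fun p : X × Y ↦ ((u p.1 * v p.2 : ℝ) : ℂ) * k p := by
    refine HasCompactSupport.intro (huc.prod hvc) fun p hp ↦ ?_
    rw [Set.mem_prod, not_and_or] at hp
    rcases hp with hp | hp
    · simp [image_eq_zero_of_notMem_tsupport hp]
    · simp [image_eq_zero_of_notMem_tsupport hp]
  refine (hs.stronglyMeasurable_of_prod hc).aestronglyMeasurable.congr ?_
  filter_upwards [ae_restrict_mem ((hK i).measurableSet.prod (hL j).measurableSet)] with p hp
  have h1 : u p.1 = 1 := hu1 hp.1
  have h2 : v p.2 = 1 := hv1 hp.2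
  simp [h1, h2]

end Product

/-! ### Fubini for the Fourier–Stieltjes transform -/

section

variable {G : Type*} [CommGroup G] [TopologicalSpace G] [IsTopologicalGroup G]
  [T2Space G] [LocallyCompactSpace G] [MeasurableSpace G] [BorelSpace G]
  [MeasurableSpace (PontryaginDual G)] [BorelSpace (PontryaginDual G)]

theorem integrable_character_mul_density (m : Measure (PontryaginDual G)) [IsFiniteMeasure m]
    [m.InnerRegularCompactLTTop] (ν : Measure G) [IsFiniteMeasure ν] [ν.InnerRegularCompactLTTop]
    {h : G → ℂ} (hh : Integrable h ν) (x : G) :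
    Integrable (fun p : PontryaginDual G × G ↦ ((p.1 (x * p.2⁻¹) : Circle) : ℂ) * h p.2)
      (m.prod ν) := by
  have hk : Continuous fun p : PontryaginDual G × G ↦ ((p.1 (x * p.2⁻¹) : Circle) : ℂ) :=
    continuous_pontryaginDual_eval.comp
      (by fun_prop : Continuous fun p : PontryaginDual G × G ↦ (p.1, x * p.2⁻¹))
  exact (hh.comp_snd m).bdd_mul (c := 1)
    (aestronglyMeasurable_prod_of_continuous m ν hk) (ae_of_all _ fun p ↦ (Circle.norm_coe _).le)

/-- Fubini's theorem for the Fourier-Stieltjes transform against a finite measure. -/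
theorem integral_character_mul_fourierTransform (m : Measure (PontryaginDual G))
    [IsFiniteMeasure m] [m.InnerRegularCompactLTTop] {μ : ComplexMeasure G}
    [μ.variation.InnerRegularCompactLTTop] {h : G → ℂ} (hint : Integrable h μ.variation)
    (hh1 : ∀ᵐ x ∂μ.variation, ‖h x‖ = 1)
    (hh : ∀ s, MeasurableSet s → μ s = ∫ x in s, h x ∂μ.variation) (x : G) :
    ∫ γ, ((γ x : Circle) : ℂ) * fourierTransform μ γ ∂m
      = ∫ y, (∫ γ, ((γ (x * y⁻¹) : Circle) : ℂ) ∂m) * h y ∂μ.variation := by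
  have hswap := integral_integral_swap
    (f := fun (γ : PontryaginDual G) (y : G) ↦ ((γ (x * y⁻¹) : Circle) : ℂ) * h y)
    (integrable_character_mul_density m μ.variation hint x)
  simp only [integral_mul_const] at hswap
  rw [← hswap]
  congr 1 with γ
  have hγ : Integrable (fun y : G ↦ (starRingEnd ℂ) ((γ y : Circle) : ℂ)) μ.variation := by
    have hc : Continuous fun y : G ↦ ((γ y : Circle) : ℂ) :=
      continuous_pontryaginDual_eval.comp (by fun_prop : Continuous fun y : G ↦ (γ, y))
    refine .of_bound (Complex.continuous_conj.comp hc).aestronglyMeasurable 1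
      (ae_of_all _ fun y ↦ ?_)
    rw [RCLike.norm_conj, Circle.norm_coe]
  rw [fourierTransform, integral_mul_eq_of_density hint hh1 hh hγ, ← integral_const_mul]
  congr 1 with y
  rw [map_mul, map_inv, Circle.coe_mul, Circle.coe_inv_eq_conj, mul_assoc]

end

end WienerFolner

/-! ### Dominated convergence -/

theorem mainTheorem2 {G : Type*} [CommGroup G] [TopologicalSpace G] [IsTopologicalGroup G]
    [T2Space G] [LocallyCompactSpace G] [MeasurableSpace G] [BorelSpace G]
    [MeasurableSpace (PontryaginDual G)] [BorelSpace (PontryaginDual G)]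
    (m : MeasureTheory.Measure (PontryaginDual G)) [m.IsHaarMeasure] [m.Regular]
    (μ : MeasureTheory.ComplexMeasure G) (hμ : μ.variation.Regular)
    (F : ℕ → Set (PontryaginDual G))
    (hF : IsFoelner (PontryaginDual G) m Filter.atTop F) (x : G) :
    Filter.Tendsto
      (fun n : ℕ => ((m.real (F n) : ℝ) : ℂ)⁻¹ *
        ∫ γ in F n, ((γ x : Circle) : ℂ) * WienerFolner.fourierTransform μ γ ∂m)
      Filter.atTop (nhds (μ {x})) := by
  obtain ⟨h, hint, hh1, hh⟩ := WienerFolner.exists_density_variation μ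
  let a : ℕ → G → ℂ := fun n y ↦
    ((m.real (F n) : ℝ) : ℂ)⁻¹ * ∫ γ in F n, ((γ y : Circle) : ℂ) ∂m
  have ha : ∀ y, Tendsto (fun n ↦ a n y) atTop (𝓝 (Set.indicator {1} 1 y)) :=
    WienerFolner.tendsto_average_apply hF
  -- Fubini needs finite measures, and `m` need not even be σ-finite; its restriction to `F n` is
  -- eventually finite and inner regular.
  have hgood : ∀ᶠ n in atTop, IsFiniteMeasure (m.restrict (F n)) ∧
      (m.restrict (F n)).InnerRegularCompactLTTop ∧ m.real (F n) ≠ 0 := by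
    filter_upwards [hF.eventually_meas_ne_zero, hF.eventually_meas_ne_top,
      hF.eventually_measurableSet] with n h0 ht hm
    exact ⟨⟨by simpa using ht.lt_top⟩, inferInstance, (ENNReal.toReal_pos h0 ht).ne'⟩
  have hlim : Tendsto (fun n ↦ ∫ y, a n (x * y⁻¹) * h y ∂μ.variation) atTop
      (𝓝 (∫ y, Set.indicator {1} 1 (x * y⁻¹) * h y ∂μ.variation)) := by
    refine tendsto_integral_filter_of_dominated_convergence (fun y ↦ ‖h y‖) ?_ ?_ hint.norm
      (ae_of_all _ fun y ↦ (ha _).mul_const _)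
    · filter_upwards [hgood] with n ⟨h1, h2, _⟩
      have := ((WienerFolner.integrable_character_mul_density (m.restrict (F n)) μ.variation
        hint x).integral_prod_right.aestronglyMeasurable).const_mul (((m.real (F n) : ℝ) : ℂ)⁻¹)
      simpa only [integral_mul_const, a, mul_assoc] using this
    · filter_upwards [hgood] with n ⟨h1, h2, h3⟩
      refine ae_of_all _ fun y ↦ ?_
      rw [norm_mul]
      refine mul_le_of_le_one_left (norm_nonneg _) ?_
      have hle := norm_integral_le_of_norm_le_const (μ := m.restrict (F n))
        (f := fun γ : PontryaginDual G ↦ ((γ (x * y⁻¹) : Circle) : ℂ)) (C := 1)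
        (ae_of_all _ fun γ ↦ (Circle.norm_coe _).le)
      rw [one_mul, measureReal_restrict_apply_univ] at hle
      rw [norm_mul, norm_inv, Complex.norm_real, Real.norm_of_nonneg measureReal_nonneg]
      exact inv_mul_le_one_of_le₀ hle measureReal_nonneg
  have hval : ∫ y, Set.indicator {1} 1 (x * y⁻¹) * h y ∂μ.variation = μ {x} := by
    rw [hh _ (measurableSet_singleton x), ← integral_indicator (measurableSet_singleton x)]
    congr 1 with y
    by_cases hy : y = x
    · simp [hy]
    · simp [hy, mul_inv_eq_one, Ne.symm hy]
  rw [hval] at hlim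
  refine hlim.congr' ?_
  filter_upwards [hgood] with n ⟨h1, h2, _⟩
  rw [WienerFolner.integral_character_mul_fourierTransform _ hint hh1 hh, ← integral_const_mul]
  simp only [a, mul_assoc]
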